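/- Let $\mathcal H_a,\mathcal H_b$ be finite-dimensional complex Hilbert spaces, and let $\{\Pi_k\}$ be a projective measurement on $\mathcal H_a$, i.e. finitely many mutually orthogonal orthogonal projections with $\sum_k\Pi_k=\mathbb 1$ (for example the rank-one projections $|k\rangle\langle k|$ of an orthonormal basis). Put $\Pi^a(X)=\sum_k(\Pi_k\otimes\mathbb 1)X(\Pi_k\otimes\mathbb 1)$ for operators $X$ on $\mathcal H_a\otimes\mathcal H_b$, and let $\mathcal I_p=\{\sigma:\ \sigma\text{ is a state on }\mathcal H_a\otimes\mathcal H_b,\ \Pi^a(\sigma)=\sigma\}$ be the set of partially incoherent states (a state is a positive semidefinite operator of trace one). For a strength $x\in\mathbb R$ put $\tau_1=\sqrt{(1-\tanh x)/2}$, $\tau_2=\sqrt{(1+\tanh x)/2}$, $\tau=2\tau_1\tau_2=\operatorname{sech}x$. Let $\Omega$ be either of the following weak measurement maps: (i) if the measurement consists of two projections $\Pi_1,\Pi_2$, $$\Omega(X)=\sum_{k=\pm x}(\Omega_k\otimes\mathbb 1)X(\Omega_k\otimes\mathbb 1),\qquad \Omega_x=\tau_1\Pi_1+\tau_2\Pi_2,\quad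 \Omega_{-x}=\tau_2\Pi_1+\tau_1\Pi_2;$$ (ii) for any number of projections, $\Omega(X)=\tau X+(1-\tau)\Pi^a(X)$. Define the coherence relative to the weak measurement by $C_H(\rho|\Omega)=\|\sqrt\rho-\Omega(\sqrt\rho)\|^2$, where $\|Y\|=\sqrt{\operatorname{tr}(Y^\dagger Y)}$. Let $\Phi$ be a completely positive trace preserving map on the operators on $\mathcal H_a\otimes\mathcal H_b$, i.e. $\Phi(X)=\sum_k A_kXA_k^\dagger$ with finitely many operators $A_k$ satisfying $\sum_kA_k^\dagger A_k=\mathbb 1$, and suppose that $\Phi$ is partially incoherent, i.e. $\Phi(\mathcal I_p)\subseteq\mathcal I_p$. Then for every state $\rho$ on $\mathcal H_a\otimes\mathcal H_b$, $$C_H(\Phi(\rho)|\Omega)\le C_H(\rho|\Omega).$$ -/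

import Mathlib

open scoped Kronecker ComplexOrder

noncomputable section

namespace WeakCoherence

/-- Density matrices (states): positive semidefinite with unit trace. -/
def IsState {n : Type*} [Fintype n] (ρ : Matrix n n ℂ) : Prop :=
  ρ.PosSemidef ∧ ρ.trace = 1

open scoped MatrixOrder in
/-- The positive semidefinite square root of a positive semidefinite matrix. -/
def msqrt {n : Type*} [Fintype n] [DecidableEq n] (ρ : Matrix n n ℂ) : Matrix n n ℂ :=
  CFC.sqrt ρ

/-- The Hilbert-Schmidt norm `√(tr(X†X))`. -/
def hsNorm {n : Type*} [Fintype n] (X : Matrix n n ℂ) : ℝ :=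
  Real.sqrt (Matrix.trace (Matrix.conjTranspose X * X)).re

/-- Hellinger coherence relative to a map `M` on matrices: `‖√ρ - M(√ρ)‖²`. -/
def coherence {n : Type*} [Fintype n] [DecidableEq n]
    (M : Matrix n n ℂ → Matrix n n ℂ) (ρ : Matrix n n ℂ) : ℝ :=
  hsNorm (msqrt ρ - M (msqrt ρ)) ^ 2

/-- A projective measurement: mutually orthogonal orthogonal projections summing to the identity.
Rank-one projections `|k⟩⟨k|` onto the vectors of an orthonormal basis are a special case. -/
structure IsProjectiveMeasurement {a : Type*} [Fintype a] [DecidableEq a] {m : ℕ}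
    (P : Fin m → Matrix a a ℂ) : Prop where
  hermitian : ∀ k, (P k).IsHermitian
  idem : ∀ k, P k * P k = P k
  orthogonal : ∀ j k, j ≠ k → P j * P k = 0
  complete : ∑ k, P k = 1

/-- The local measurement map `Π^a(X) = ∑ₖ (Pₖ ⊗ 1) X (Pₖ ⊗ 1)`. -/
def localMeas {a b : Type*} [Fintype a] [Fintype b] [DecidableEq b] {m : ℕ}
    (P : Fin m → Matrix a a ℂ) (X : Matrix (a × b) (a × b) ℂ) : Matrix (a × b) (a × b) ℂ :=
  ∑ k, (P k ⊗ₖ (1 : Matrix b b ℂ)) * X * (P k ⊗ₖ (1 : Matrix b b ℂ))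

/-- The set `I_p` of partially incoherent states: states `ρ` with `Π^a(ρ) = ρ`. -/
def partiallyIncoherent {a : Type*} (b : Type*) [Fintype a] [Fintype b] [DecidableEq b] {m : ℕ}
    (P : Fin m → Matrix a a ℂ) : Set (Matrix (a × b) (a × b) ℂ) :=
  {ρ | IsState ρ ∧ localMeas P ρ = ρ}

/-- The weight `τ₁ = √((1 - tanh x)/2)`. -/
def tau₁ (x : ℝ) : ℝ := Real.sqrt ((1 - Real.tanh x) / 2)

/-- The weight `τ₂ = √((1 + tanh x)/2)`. -/
def tau₂ (x : ℝ) : ℝ := Real.sqrt ((1 + Real.tanh x) / 2)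

/-- The two-outcome weak measurement operator `Ω_x = τ₁ P₁ + τ₂ P₂`. -/
def weakOpPos {a : Type*} (x : ℝ) (P : Fin 2 → Matrix a a ℂ) : Matrix a a ℂ :=
  (tau₁ x : ℂ) • P 0 + (tau₂ x : ℂ) • P 1

/-- The two-outcome weak measurement operator `Ω_{-x} = τ₂ P₁ + τ₁ P₂`. -/
def weakOpNeg {a : Type*} (x : ℝ) (P : Fin 2 → Matrix a a ℂ) : Matrix a a ℂ :=
  (tau₂ x : ℂ) • P 0 + (tau₁ x : ℂ) • P 1

/-- The weak measurement map `Ω(X) = ∑_{k = ±x} (Ω_k ⊗ 1) X (Ω_k ⊗ 1)` of two projections. -/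
def weakMeas {a b : Type*} [Fintype a] [Fintype b] [DecidableEq b]
    (x : ℝ) (P : Fin 2 → Matrix a a ℂ) (X : Matrix (a × b) (a × b) ℂ) :
    Matrix (a × b) (a × b) ℂ :=
  (weakOpPos x P ⊗ₖ (1 : Matrix b b ℂ)) * X * (weakOpPos x P ⊗ₖ (1 : Matrix b b ℂ)) +
    (weakOpNeg x P ⊗ₖ (1 : Matrix b b ℂ)) * X * (weakOpNeg x P ⊗ₖ (1 : Matrix b b ℂ))

/-- The weak measurement map `Ω(X) = τ X + (1 - τ) Π^a(X)`, `τ = 2 τ₁ τ₂ = sech x`, of a projective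
measurement with any number of outcomes. -/
def weakMeasMix {a b : Type*} [Fintype a] [Fintype b] [DecidableEq b] {m : ℕ}
    (x : ℝ) (P : Fin m → Matrix a a ℂ) (X : Matrix (a × b) (a × b) ℂ) :
    Matrix (a × b) (a × b) ℂ :=
  ((2 * tau₁ x * tau₂ x : ℝ) : ℂ) • X + ((1 - 2 * tau₁ x * tau₂ x : ℝ) : ℂ) • localMeas P X

/-- Completely positive trace preserving maps: `Φ(X) = ∑ₖ Aₖ X Aₖ†` with `∑ₖ Aₖ† Aₖ = 1`. -/
def IsCPTP {n : Type*} [Fintype n] [DecidableEq n]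
    (Φ : Matrix n n ℂ →ₗ[ℂ] Matrix n n ℂ) : Prop :=
  ∃ (r : ℕ) (A : Fin r → Matrix n n ℂ),
    ∑ k, Matrix.conjTranspose (A k) * A k = 1 ∧
      ∀ X, Φ X = ∑ k, A k * X * Matrix.conjTranspose (A k)

/-- A partially incoherent CPTP map: a CPTP map `Φ` with `Φ(I_p) ⊆ I_p`. -/
def IsPartiallyIncoherentCPTP {a b : Type*} [Fintype a] [DecidableEq a] [Fintype b] [DecidableEq b]
    {m : ℕ} (P : Fin m → Matrix a a ℂ)
    (Φ : Matrix (a × b) (a × b) ℂ →ₗ[ℂ] Matrix (a × b) (a × b) ℂ) : Prop :=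
  IsCPTP Φ ∧ Φ '' partiallyIncoherent b P ⊆ partiallyIncoherent b P

end WeakCoherence

end

/-!
For a pinching `Π`, the distance `‖√ρ - Π(√ρ)‖` is the Hellinger distance from `ρ` to the cone of
positive operators fixed by `Π`: `Π` is an orthogonal projection, and the minimum is attained at
`(Π(√ρ))²`. A partially incoherent channel `Φ` preserves this cone, so it suffices that the
Hellinger distance contracts under `Φ`, that is, that the affinity `tr(√ρ√σ)` does not decrease.

The affinity is `⟨1, √(L_ρ R_σ) 1⟩` for the commuting operators `L_ρ` of left multiplication by `ρ`
and `R_σ` of right multiplication by `σ`. The dual map `W` of `Φ` is unital and satisfies the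
Kadison-Schwarz inequalities `W⋆ L_ρ W ≤ L_{Φρ}` and `W⋆ R_σ W ≤ R_{Φσ}`. Since the geometric mean
`√(LR)` of commuting positive operators is the largest self-adjoint off-diagonal block that makes
`[[L, X], [X, R]]` positive, it follows that `W⋆ √(L_ρ R_σ) W ≤ √(L_{Φρ} R_{Φσ})`, and evaluating at
the identity matrix gives the claim.

Both weak measurement maps are `τ • id + (1 - τ) • Π`, which only rescales the coherence by
`(1 - τ)²`.
-/

namespace WeakCoherence

open Matrix

section CStarAlgebra

variable {𝒜 : Type*} [CStarAlgebra 𝒜] [PartialOrder 𝒜] [StarOrderedRing 𝒜]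

theorem le_of_mul_self_le_mul_self {a b : 𝒜} (ha : IsSelfAdjoint a) (hb : 0 ≤ b)
    (h : a * a ≤ b * b) : a ≤ b :=
  calc
    a ≤ CFC.abs a := by
      rw [← sub_nonneg, CFC.abs_sub_self a]
      exact smul_nonneg zero_le_two (CFC.negPart_nonneg a)
    _ = CFC.sqrt (a * a) := by rw [CFC.abs, ha.star_eq]
    _ ≤ CFC.sqrt (b * b) := CFC.sqrt_le_sqrt _ _ h
    _ = b := CFC.sqrt_mul_self b

theorem mul_star_self_le_one {a : 𝒜} (h : star a * a ≤ 1) : a * star a ≤ 1 := by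
  rw [← CStarAlgebra.norm_le_one_iff_of_nonneg (star a * a) (star_mul_self_nonneg a),
    CStarRing.norm_star_mul_self, ← CStarRing.norm_self_mul_star] at h
  exact (CStarAlgebra.norm_le_one_iff_of_nonneg _ (mul_star_self_nonneg a)).1 h

theorem star_mul_le_of_star_mul_self_le {a k l : 𝒜} (ha : 0 ≤ a) (hk : star k * k ≤ a * a)
    (hl : star l * l ≤ 1) (hkl : IsSelfAdjoint (star k * l)) : star k * l ≤ a := by
  refine le_of_mul_self_le_mul_self hkl ha ?_
  calc
    star k * l * (star k * l) = star k * (l * star l) * k := by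
      nth_rw 2 [← hkl.star_eq]
      simp only [star_mul, star_star, mul_assoc]
    _ ≤ star k * 1 * k := star_left_conjugate_le_conjugate (mul_star_self_le_one hl) k
    _ ≤ a * a := by rwa [mul_one]

theorem star_mul_le_mul_of_isStrictlyPositive {a b k l : 𝒜} (ha : 0 ≤ a)
    (hb : IsStrictlyPositive b) (hab : Commute a b) (hk : star k * k ≤ a * a)
    (hl : star l * l ≤ b * b) (hkl : IsSelfAdjoint (star k * l)) : star k * l ≤ a * b := by
  have hb0 := hb.nonneg
  lift b to 𝒜ˣ using hb.isUnit
  set c : 𝒜 := ↑b⁻¹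
  have hc0 : 0 ≤ c := CFC.inv_nonneg_of_nonneg b hb0
  have hcs : star c = c := (IsSelfAdjoint.of_nonneg hc0).star_eq
  have hac : Commute a c := hab.units_inv_right
  have hbc : (b : 𝒜) * c = 1 := b.mul_inv
  have hcb : c * (b : 𝒜) = 1 := b.inv_mul
  have hscaled : star (k * c) * (l * c) ≤ a * c := by
    refine star_mul_le_of_star_mul_self_le (hac.mul_nonneg ha hc0) ?_ ?_ ?_
    · calc
        star (k * c) * (k * c) = star c * (star k * k) * c := by simp only [star_mul, mul_assoc]
        _ ≤ star c * (a * a) * c := star_left_conjugate_le_conjugate hk c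
        _ = a * c * (a * c) := by rw [hcs, ← mul_assoc, ← hac.eq, mul_assoc]
    · calc
        star (l * c) * (l * c) = star c * (star l * l) * c := by simp only [star_mul, mul_assoc]
        _ ≤ star c * (b * b) * c := star_left_conjugate_le_conjugate hl c
        _ = 1 := by rw [hcs, ← mul_assoc, hcb, one_mul, hbc]
    · simpa only [star_mul, mul_assoc] using hkl.conjugate' c
  calc
    star k * l = b * (star (k * c) * (l * c)) * b := by
      simp only [star_mul, hcs, ← mul_assoc, hbc, one_mul]
      rw [mul_assoc _ c, hcb, mul_one]
    _ ≤ b * (a * c) * b := conjugate_le_conjugate_of_nonneg hscaled hb0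
    _ = a * b := by rw [mul_assoc, mul_assoc, hcb, mul_one, hab.eq]

theorem star_mul_le_mul_of_star_mul_self_le {a b k l : 𝒜} (ha : 0 ≤ a) (hb : 0 ≤ b)
    (hab : Commute a b) (hk : star k * k ≤ a * a) (hl : star l * l ≤ b * b)
    (hkl : IsSelfAdjoint (star k * l)) : star k * l ≤ a * b := by
  have hperturbed (ε : ℝ) (hε : 0 < ε) : star k * l ≤ a * (b + algebraMap ℝ 𝒜 ε) := by
    have hε0 : 0 ≤ algebraMap ℝ 𝒜 ε := algebraMap_nonneg 𝒜 hε.le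
    have hcomm (x : 𝒜) : Commute x (algebraMap ℝ 𝒜 ε) := (Algebra.commutes ε x).symm
    refine star_mul_le_mul_of_isStrictlyPositive ha
      (IsStrictlyPositive.nonneg_add hb (isStrictlyPositive_algebraMap hε))
      (hab.add_right (hcomm a)) hk (hl.trans ?_) hkl
    rw [add_mul, mul_add, add_assoc]
    refine le_add_of_nonneg_right (add_nonneg ((hcomm b).mul_nonneg hb hε0) ?_)
    exact (hcomm _).symm.mul_nonneg hε0 (add_nonneg hb hε0)
  have hlim : Filter.Tendsto (fun ε : ℝ => a * (b + algebraMap ℝ 𝒜 ε)) (nhdsWithin 0 (Set.Ioi 0))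
      (nhds (a * b)) := by
    have hcont : Continuous fun ε : ℝ => a * (b + algebraMap ℝ 𝒜 ε) := by fun_prop
    simpa using (hcont.tendsto 0).mono_left nhdsWithin_le_nhds
  exact ge_of_tendsto hlim (Filter.eventually_of_mem self_mem_nhdsWithin hperturbed)

theorem star_mul_mul_mul_le_mul {a b c d w : 𝒜} (ha : 0 ≤ a) (hb : 0 ≤ b) (hc : 0 ≤ c)
    (hd : 0 ≤ d) (hab : Commute a b) (hcd : Commute c d) (hac : star w * (a * a) * w ≤ c * c)
    (hbd : star w * (b * b) * w ≤ d * d) : star w * (a * b) * w ≤ c * d := by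
  have hconj {e f : 𝒜} (he : 0 ≤ e) : star (e * w) * (f * w) = star w * (e * f) * w := by
    rw [star_mul, (IsSelfAdjoint.of_nonneg he).star_eq]
    simp only [mul_assoc]
  rw [← hconj ha] at hac ⊢
  rw [← hconj hb] at hbd
  refine star_mul_le_mul_of_star_mul_self_le hc hd hcd hac hbd ?_
  rw [hconj ha]
  exact (IsSelfAdjoint.of_nonneg (hab.mul_nonneg ha hb)).conjugate' w

end CStarAlgebra

theorem star_sum_mul_mul_sum_le_sum {R ι : Type*} [Ring R] [StarRing R] [PartialOrder R]
    [StarOrderedRing R] [Fintype ι] {x : R} (hx : 0 ≤ x) (u v : ι → R)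
    (hv : ∑ i, star (v i) * v i = 1) (hxv : ∀ i, Commute x (v i)) :
    star (∑ i, star (v i) * u i) * x * (∑ i, star (v i) * u i) ≤ ∑ i, star (u i) * x * u i := by
  have hxv' (i : ι) : Commute x (star (v i)) := by
    simpa only [(IsSelfAdjoint.of_nonneg hx).star_eq] using (hxv i).star_star
  set w := ∑ i, star (v i) * u i with hw
  have hw' : ∑ i, star (u i) * v i = star w := by simp [hw, star_sum]
  have hgap : ∑ i, star (u i - v i * w) * x * (u i - v i * w) =
      ∑ i, star (u i) * x * u i - star w * x * w := by
    have hterm (i : ι) : star (u i - v i * w) * x * (u i - v i * w) =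
        star (u i) * x * u i - star (u i) * v i * (x * w) - star w * x * (star (v i) * u i) +
          star w * (star (v i) * v i) * (x * w) := by
      have h₁ : x * v i = v i * x := hxv i
      have h₂ : star (v i) * x = x * star (v i) := (hxv' i).symm
      simp only [star_sub, star_mul, sub_mul, mul_sub, mul_assoc]
      simp only [← mul_assoc, h₂, h₁]
      simp only [mul_assoc, ← h₂]
      abel
    simp only [hterm, Finset.sum_add_distrib, Finset.sum_sub_distrib, ← Finset.sum_mul,
      ← Finset.mul_sum, hv, hw', ← hw, mul_one]
    simp only [mul_assoc]
    abel
  rw [← sub_nonneg, ← hgap]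
  exact Finset.sum_nonneg fun i _ => star_left_conjugate_nonneg hx _

section HilbertSchmidt

variable {n : Type*} [Fintype n]

theorem re_trace_conjTranspose_mul_self_nonneg (X : Matrix n n ℂ) : 0 ≤ (Xᴴ * X).trace.re :=
  (Complex.nonneg_iff.1 (posSemidef_conjTranspose_mul_self X).trace_nonneg).1

theorem hsNorm_sq (X : Matrix n n ℂ) : hsNorm X ^ 2 = (Xᴴ * X).trace.re :=
  Real.sq_sqrt (re_trace_conjTranspose_mul_self_nonneg X)

theorem hsNorm_nonneg (X : Matrix n n ℂ) : 0 ≤ hsNorm X := Real.sqrt_nonneg _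

theorem hsNorm_ofReal_smul_sq (c : ℝ) (X : Matrix n n ℂ) :
    hsNorm ((c : ℂ) • X) ^ 2 = c ^ 2 * hsNorm X ^ 2 := by
  rw [hsNorm_sq, hsNorm_sq]
  simp [sq, mul_assoc]

theorem hsNorm_add_sq_of_trace_eq_zero {X Y : Matrix n n ℂ} (h : (Xᴴ * Y).trace = 0) :
    hsNorm (X + Y) ^ 2 = hsNorm X ^ 2 + hsNorm Y ^ 2 := by
  have h' : (Yᴴ * X).trace = 0 := by
    rw [← conjTranspose_conjTranspose X, ← conjTranspose_mul, trace_conjTranspose, h, star_zero]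
  simp [hsNorm_sq, Matrix.add_mul, Matrix.mul_add, h, h']

end HilbertSchmidt

section Msqrt

variable {n : Type*} [Fintype n] [DecidableEq n]

open scoped MatrixOrder in
theorem posSemidef_msqrt (A : Matrix n n ℂ) : (msqrt A).PosSemidef :=
  (CFC.sqrt_nonneg A).posSemidef

open scoped MatrixOrder in
theorem msqrt_mul_msqrt_self {A : Matrix n n ℂ} (hA : A.PosSemidef) : msqrt A * msqrt A = A :=
  CFC.sqrt_mul_sqrt_self A hA.nonneg

open scoped MatrixOrder in
theorem msqrt_mul_self {A : Matrix n n ℂ} (hA : A.PosSemidef) : msqrt (A * A) = A :=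
  CFC.sqrt_mul_self A hA.nonneg

open scoped MatrixOrder in
theorem commute_msqrt {A B : Matrix n n ℂ} (h : Commute A B) : Commute (msqrt A) B :=
  h.cfcₙ_nnreal _

theorem hsNorm_msqrt_sub_msqrt_sq {ρ σ : Matrix n n ℂ} (hρ : ρ.PosSemidef) (hσ : σ.PosSemidef) :
    hsNorm (msqrt ρ - msqrt σ) ^ 2 =
      ρ.trace.re + σ.trace.re - 2 * (msqrt ρ * msqrt σ).trace.re := by
  rw [hsNorm_sq, conjTranspose_sub, (posSemidef_msqrt ρ).1.eq, (posSemidef_msqrt σ).1.eq,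
    Matrix.sub_mul, Matrix.mul_sub, Matrix.mul_sub, msqrt_mul_msqrt_self hρ,
    msqrt_mul_msqrt_self hσ, trace_sub, trace_sub, trace_sub, trace_mul_comm (msqrt σ)]
  simp only [Complex.sub_re]
  ring

end Msqrt

section Kronecker

variable {l m n p ι R : Type*} [CommSemiring R]

theorem sum_kronecker (s : Finset ι) (A : ι → Matrix l m R) (B : Matrix n p R) :
    (∑ i ∈ s, A i) ⊗ₖ B = ∑ i ∈ s, A i ⊗ₖ B :=
  map_sum ((kroneckerBilinear (R := R)).flip B) A s

theorem kronecker_sum (s : Finset ι) (A : Matrix l m R) (B : ι → Matrix n p R) :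
    A ⊗ₖ (∑ i ∈ s, B i) = ∑ i ∈ s, A ⊗ₖ B i :=
  map_sum (kroneckerBilinear (R := R) A) B s

end Kronecker

section Kraus

variable {m n ι : Type*} [Fintype n] [Fintype ι]

theorem posSemidef_sum_mul_mul_conjTranspose [Finite m] (A : ι → Matrix m n ℂ) {ρ : Matrix n n ℂ}
    (hρ : ρ.PosSemidef) : (∑ k, A k * ρ * (A k)ᴴ).PosSemidef :=
  posSemidef_sum _ fun k _ => hρ.mul_mul_conjTranspose_same (A k)

variable [DecidableEq n]

/-- The matrix of the dual map `X ↦ ∑ (A k)ᴴ * X * A k` of a Kraus family acting on vectorised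
matrices. In the column-stacking convention of `Matrix.vec`, left multiplication by `ρ` has matrix
`1 ⊗ₖ ρ` and right multiplication by `σ` has matrix `σᵀ ⊗ₖ 1`. -/
def dualKrausMatrix (A : ι → Matrix n n ℂ) : Matrix (n × n) (n × n) ℂ :=
  ∑ k, (A k)ᵀ ⊗ₖ (A k)ᴴ

variable {A : ι → Matrix n n ℂ}

theorem dualKrausMatrix_mulVec_vec_one (hA : ∑ k, (A k)ᴴ * A k = 1) :
    dualKrausMatrix A *ᵥ vec 1 = vec (1 : Matrix n n ℂ) := by
  simp only [dualKrausMatrix, sum_mulVec, kronecker_mulVec_vec, transpose_transpose,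
    Matrix.mul_one, ← vec_sum, hA]

open scoped MatrixOrder in
theorem conjTranspose_dualKrausMatrix_mul_one_kronecker_mul_le (hA : ∑ k, (A k)ᴴ * A k = 1)
    {ρ : Matrix n n ℂ} (hρ : ρ.PosSemidef) :
    (dualKrausMatrix A)ᴴ * (1 ⊗ₖ ρ) * dualKrausMatrix A ≤ 1 ⊗ₖ ∑ k, A k * ρ * (A k)ᴴ := by
  have hA' : ∑ k, (A k)ᵀ * (A k)ᵀᴴ = 1 := by
    have h := congrArg transpose hA
    simp only [transpose_one, transpose_sum, transpose_mul] at h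
    exact h
  have h := star_sum_mul_mul_sum_le_sum (x := (1 : Matrix n n ℂ) ⊗ₖ ρ)
    (PosSemidef.one.kronecker hρ).nonneg
    (fun k => 1 ⊗ₖ (A k)ᴴ) (fun k => (A k)ᵀᴴ ⊗ₖ 1) ?_ fun k => ?_
  · simpa only [star_eq_conjTranspose, conjTranspose_kronecker, conjTranspose_conjTranspose,
      conjTranspose_one, ← mul_kronecker_mul, Matrix.mul_one, Matrix.one_mul, ← kronecker_sum,
      dualKrausMatrix] using h
  · simp only [star_eq_conjTranspose, conjTranspose_kronecker, conjTranspose_conjTranspose,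
      conjTranspose_one, ← mul_kronecker_mul, Matrix.mul_one, ← sum_kronecker, hA',
      one_kronecker_one]
  · simp only [commute_iff_eq, ← mul_kronecker_mul, Matrix.mul_one, Matrix.one_mul]

open scoped MatrixOrder in
theorem conjTranspose_dualKrausMatrix_mul_transpose_kronecker_one_mul_le
    (hA : ∑ k, (A k)ᴴ * A k = 1) {σ : Matrix n n ℂ} (hσ : σ.PosSemidef) :
    (dualKrausMatrix A)ᴴ * (σᵀ ⊗ₖ 1) * dualKrausMatrix A ≤ (∑ k, A k * σ * (A k)ᴴ)ᵀ ⊗ₖ 1 := by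
  have hsum : ∑ k, (A k)ᵀᴴ * σᵀ * (A k)ᵀ = (∑ k, A k * σ * (A k)ᴴ)ᵀ := by
    simp only [transpose_sum, transpose_mul, Matrix.mul_assoc]
    rfl
  have h := star_sum_mul_mul_sum_le_sum (x := σᵀ ⊗ₖ (1 : Matrix n n ℂ))
    (hσ.transpose.kronecker PosSemidef.one).nonneg
    (fun k => (A k)ᵀ ⊗ₖ 1) (fun k => 1 ⊗ₖ A k) ?_ fun k => ?_
  · simpa only [star_eq_conjTranspose, conjTranspose_kronecker, conjTranspose_one,
      ← mul_kronecker_mul, Matrix.mul_one, Matrix.one_mul, ← sum_kronecker, hsum,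
      dualKrausMatrix] using h
  · simp only [star_eq_conjTranspose, conjTranspose_kronecker, ← mul_kronecker_mul,
      ← kronecker_sum, conjTranspose_one, Matrix.mul_one, hA, one_kronecker_one]
  · simp only [commute_iff_eq, ← mul_kronecker_mul, Matrix.mul_one, Matrix.one_mul]

open scoped MatrixOrder Matrix.Norms.L2Operator in
theorem conjTranspose_dualKrausMatrix_mul_msqrt_kronecker_msqrt_mul_le
    (hA : ∑ k, (A k)ᴴ * A k = 1) {ρ σ : Matrix n n ℂ}
    (hρ : ρ.PosSemidef) (hσ : σ.PosSemidef) :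
    (dualKrausMatrix A)ᴴ * ((msqrt σ)ᵀ ⊗ₖ msqrt ρ) * dualKrausMatrix A ≤
      (msqrt (∑ k, A k * σ * (A k)ᴴ))ᵀ ⊗ₖ msqrt (∑ k, A k * ρ * (A k)ᴴ) := by
  have hL (τ : Matrix n n ℂ) : 0 ≤ (1 : Matrix n n ℂ) ⊗ₖ msqrt τ :=
    (PosSemidef.one.kronecker (posSemidef_msqrt τ)).nonneg
  have hR (τ : Matrix n n ℂ) : 0 ≤ (msqrt τ)ᵀ ⊗ₖ (1 : Matrix n n ℂ) :=
    ((posSemidef_msqrt τ).transpose.kronecker PosSemidef.one).nonneg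
  have hLL {τ : Matrix n n ℂ} (hτ : τ.PosSemidef) :
      ((1 : Matrix n n ℂ) ⊗ₖ msqrt τ) * (1 ⊗ₖ msqrt τ) = 1 ⊗ₖ τ := by
    rw [← mul_kronecker_mul, msqrt_mul_msqrt_self hτ, Matrix.one_mul]
  have hRR {τ : Matrix n n ℂ} (hτ : τ.PosSemidef) :
      ((msqrt τ)ᵀ ⊗ₖ (1 : Matrix n n ℂ)) * ((msqrt τ)ᵀ ⊗ₖ 1) = τᵀ ⊗ₖ 1 := by
    rw [← mul_kronecker_mul, ← transpose_mul, msqrt_mul_msqrt_self hτ, Matrix.one_mul]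
  have hLR (X Y : Matrix n n ℂ) : (1 ⊗ₖ X) * (Yᵀ ⊗ₖ 1) = Yᵀ ⊗ₖ X := by
    rw [← mul_kronecker_mul, Matrix.one_mul, Matrix.mul_one]
  have hcomm (X Y : Matrix n n ℂ) : Commute (1 ⊗ₖ X) (Yᵀ ⊗ₖ 1) := by
    simp only [commute_iff_eq, ← mul_kronecker_mul, Matrix.mul_one, Matrix.one_mul]
  have hgeom := star_mul_mul_mul_le_mul (w := dualKrausMatrix A)
    (hL ρ) (hR σ) (hL (∑ k, A k * ρ * (A k)ᴴ)) (hR (∑ k, A k * σ * (A k)ᴴ))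
    (hcomm _ _) (hcomm _ _) ?_ ?_
  · rwa [hLR, hLR] at hgeom
  · rw [hLL hρ, hLL (posSemidef_sum_mul_mul_conjTranspose A hρ)]
    exact conjTranspose_dualKrausMatrix_mul_one_kronecker_mul_le hA hρ
  · rw [hRR hσ, hRR (posSemidef_sum_mul_mul_conjTranspose A hσ)]
    exact conjTranspose_dualKrausMatrix_mul_transpose_kronecker_one_mul_le hA hσ

theorem star_vec_one_dotProduct_transpose_kronecker_mulVec_vec_one (B C : Matrix n n ℂ) :
    star (vec 1) ⬝ᵥ (Bᵀ ⊗ₖ C) *ᵥ vec 1 = (C * B).trace := by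
  rw [kronecker_mulVec_vec, star_vec_dotProduct_vec, transpose_transpose, conjTranspose_one,
    Matrix.one_mul, Matrix.mul_one]

variable {Φ : Matrix n n ℂ →ₗ[ℂ] Matrix n n ℂ}

theorem IsCPTP.posSemidef_map (hΦ : IsCPTP Φ) {ρ : Matrix n n ℂ} (hρ : ρ.PosSemidef) :
    (Φ ρ).PosSemidef := by
  obtain ⟨r, A, -, hΦA⟩ := hΦ
  exact hΦA ρ ▸ posSemidef_sum_mul_mul_conjTranspose A hρ

theorem IsCPTP.trace_map (hΦ : IsCPTP Φ) (X : Matrix n n ℂ) : (Φ X).trace = X.trace := by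
  obtain ⟨r, A, hA, hΦA⟩ := hΦ
  calc
    (Φ X).trace = ∑ k, ((A k)ᴴ * A k * X).trace := by
      rw [hΦA, trace_sum]
      exact Finset.sum_congr rfl fun k _ => trace_mul_cycle _ _ _
    _ = X.trace := by rw [← trace_sum, ← Finset.sum_mul, hA, Matrix.one_mul]

theorem IsCPTP.trace_msqrt_mul_msqrt_le (hΦ : IsCPTP Φ) {ρ σ : Matrix n n ℂ}
    (hρ : ρ.PosSemidef) (hσ : σ.PosSemidef) :
    (msqrt ρ * msqrt σ).trace ≤ (msqrt (Φ ρ) * msqrt (Φ σ)).trace := by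
  obtain ⟨r, A, hA, hΦA⟩ := hΦ
  have hle := (Matrix.le_iff.1 <| conjTranspose_dualKrausMatrix_mul_msqrt_kronecker_msqrt_mul_le
    hA hρ hσ).dotProduct_mulVec_nonneg (vec 1)
  have hone := dualKrausMatrix_mulVec_vec_one hA
  rw [← hΦA, ← hΦA, sub_mulVec, dotProduct_sub, sub_nonneg] at hle
  calc
    (msqrt ρ * msqrt σ).trace =
        star (vec 1) ⬝ᵥ ((dualKrausMatrix A)ᴴ * ((msqrt σ)ᵀ ⊗ₖ msqrt ρ) *
          dualKrausMatrix A) *ᵥ vec 1 := by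
      rw [← mulVec_mulVec, ← mulVec_mulVec, hone, dotProduct_mulVec, ← star_mulVec, hone,
        star_vec_one_dotProduct_transpose_kronecker_mulVec_vec_one]
    _ ≤ star (vec 1) ⬝ᵥ ((msqrt (Φ σ))ᵀ ⊗ₖ msqrt (Φ ρ)) *ᵥ vec 1 := hle
    _ = (msqrt (Φ ρ) * msqrt (Φ σ)).trace :=
      star_vec_one_dotProduct_transpose_kronecker_mulVec_vec_one _ _

theorem IsCPTP.hsNorm_msqrt_sub_msqrt_le (hΦ : IsCPTP Φ) {ρ σ : Matrix n n ℂ}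
    (hρ : ρ.PosSemidef) (hσ : σ.PosSemidef) :
    hsNorm (msqrt (Φ ρ) - msqrt (Φ σ)) ≤ hsNorm (msqrt ρ - msqrt σ) := by
  have haffinity := (Complex.le_def.1 (hΦ.trace_msqrt_mul_msqrt_le hρ hσ)).1
  rw [← sq_le_sq₀ (hsNorm_nonneg _) (hsNorm_nonneg _), hsNorm_msqrt_sub_msqrt_sq hρ hσ,
    hsNorm_msqrt_sub_msqrt_sq (hΦ.posSemidef_map hρ) (hΦ.posSemidef_map hσ), hΦ.trace_map,
    hΦ.trace_map]
  linarith

end Kraus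

section Pinching

variable {n ι : Type*} [Fintype n] [Fintype ι]

/-- The pinching `X ↦ ∑ Q k * X * Q k` by a family of matrices, as a linear map. The local
measurement map is the pinching by the matrices `P k ⊗ₖ 1`. -/
def pinching (Q : ι → Matrix n n ℂ) : Matrix n n ℂ →ₗ[ℂ] Matrix n n ℂ :=
  ∑ k, LinearMap.mulLeftRight ℂ (Q k, Q k)

theorem pinching_apply (Q : ι → Matrix n n ℂ) (X : Matrix n n ℂ) :
    pinching Q X = ∑ k, Q k * X * Q k := by
  simp [pinching]

theorem trace_mul_pinching (Q : ι → Matrix n n ℂ) (X Y : Matrix n n ℂ) :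
    (X * pinching Q Y).trace = (pinching Q X * Y).trace := by
  simp only [pinching_apply, Matrix.mul_sum, Matrix.sum_mul, trace_sum]
  refine Finset.sum_congr rfl fun k _ => ?_
  rw [← Matrix.mul_assoc, trace_mul_comm]
  simp only [Matrix.mul_assoc]

namespace IsProjectiveMeasurement

variable [DecidableEq n] {m : ℕ} {Q : Fin m → Matrix n n ℂ} (hQ : IsProjectiveMeasurement Q)
include hQ

theorem mul_pinching (j : Fin m) (X : Matrix n n ℂ) : Q j * pinching Q X = Q j * X * Q j := by
  rw [pinching_apply, Matrix.mul_sum, Finset.sum_eq_single_of_mem j (Finset.mem_univ j)]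
  · simp only [← Matrix.mul_assoc, hQ.idem]
  · intro k _ hk
    simp only [← Matrix.mul_assoc, hQ.orthogonal j k hk.symm, Matrix.zero_mul]

theorem pinching_mul (j : Fin m) (X : Matrix n n ℂ) : pinching Q X * Q j = Q j * X * Q j := by
  rw [pinching_apply, Matrix.sum_mul, Finset.sum_eq_single_of_mem j (Finset.mem_univ j)]
  · rw [Matrix.mul_assoc, hQ.idem]
  · intro k _ hk
    rw [Matrix.mul_assoc, hQ.orthogonal k j hk, Matrix.mul_zero]

theorem commute_pinching (j : Fin m) (X : Matrix n n ℂ) : Commute (pinching Q X) (Q j) :=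
  (hQ.pinching_mul j X).trans (hQ.mul_pinching j X).symm

theorem pinching_eq_self_of_commute {X : Matrix n n ℂ} (h : ∀ j, Commute X (Q j)) :
    pinching Q X = X := by
  have hterm (k : Fin m) : Q k * X * Q k = X * Q k := by
    rw [← (h k).eq, Matrix.mul_assoc, hQ.idem]
  simp only [pinching_apply, hterm, ← Matrix.mul_sum, hQ.complete, Matrix.mul_one]

theorem pinching_pinching (X : Matrix n n ℂ) : pinching Q (pinching Q X) = pinching Q X :=
  hQ.pinching_eq_self_of_commute fun j => hQ.commute_pinching j X

theorem pinching_mul_self {X : Matrix n n ℂ} (h : pinching Q X = X) :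
    pinching Q (X * X) = X * X := by
  have hX (j : Fin m) : Commute X (Q j) := h ▸ hQ.commute_pinching j X
  exact hQ.pinching_eq_self_of_commute fun j => (hX j).mul_left (hX j)

theorem pinching_msqrt {X : Matrix n n ℂ} (h : pinching Q X = X) :
    pinching Q (msqrt X) = msqrt X :=
  hQ.pinching_eq_self_of_commute fun j => commute_msqrt (h ▸ hQ.commute_pinching j X)

theorem posSemidef_pinching {X : Matrix n n ℂ} (hX : X.PosSemidef) : (pinching Q X).PosSemidef := by
  rw [pinching_apply]
  exact posSemidef_sum _ fun k _ => by
    simpa only [(hQ.hermitian k).eq] using hX.mul_mul_conjTranspose_same (Q k)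

theorem conjTranspose_pinching (X : Matrix n n ℂ) : (pinching Q X)ᴴ = pinching Q Xᴴ := by
  simp only [pinching_apply, conjTranspose_sum, conjTranspose_mul, (hQ.hermitian _).eq,
    Matrix.mul_assoc]

theorem hsNorm_sub_pinching_le (X : Matrix n n ℂ) : hsNorm (X - pinching Q X) ≤ hsNorm X := by
  have horth : ((pinching Q X)ᴴ * (X - pinching Q X)).trace = 0 := by
    rw [Matrix.mul_sub, trace_sub, trace_mul_pinching, ← hQ.conjTranspose_pinching,
      hQ.pinching_pinching, sub_self]
  have hpyth := hsNorm_add_sq_of_trace_eq_zero horth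
  rw [add_sub_cancel] at hpyth
  rw [← sq_le_sq₀ (hsNorm_nonneg _) (hsNorm_nonneg _), hpyth]
  exact le_add_of_nonneg_left (sq_nonneg _)

theorem hsNorm_sub_pinching_le_hsNorm_sub (X : Matrix n n ℂ) {Y : Matrix n n ℂ}
    (hY : pinching Q Y = Y) : hsNorm (X - pinching Q X) ≤ hsNorm (X - Y) := by
  have h := hQ.hsNorm_sub_pinching_le (X - Y)
  rwa [map_sub, hY, sub_sub_sub_cancel_right] at h

theorem hsNorm_msqrt_sub_pinching_msqrt_map_le {Φ : Matrix n n ℂ →ₗ[ℂ] Matrix n n ℂ}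
    (hΦ : IsCPTP Φ)
    (hΦQ : ∀ σ : Matrix n n ℂ, σ.PosSemidef → pinching Q σ = σ → pinching Q (Φ σ) = Φ σ)
    {ρ : Matrix n n ℂ} (hρ : ρ.PosSemidef) :
    hsNorm (msqrt (Φ ρ) - pinching Q (msqrt (Φ ρ))) ≤
      hsNorm (msqrt ρ - pinching Q (msqrt ρ)) := by
  set D := pinching Q (msqrt ρ)
  have hD : D.PosSemidef := hQ.posSemidef_pinching (posSemidef_msqrt ρ)
  have hDD : (D * D).PosSemidef := by
    simpa only [hD.1.eq] using posSemidef_conjTranspose_mul_self D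
  have hΦDD : pinching Q (Φ (D * D)) = Φ (D * D) :=
    hΦQ _ hDD (hQ.pinching_mul_self (hQ.pinching_pinching _))
  calc
    hsNorm (msqrt (Φ ρ) - pinching Q (msqrt (Φ ρ))) ≤
        hsNorm (msqrt (Φ ρ) - msqrt (Φ (D * D))) :=
      hQ.hsNorm_sub_pinching_le_hsNorm_sub _ (hQ.pinching_msqrt hΦDD)
    _ ≤ hsNorm (msqrt ρ - msqrt (D * D)) := hΦ.hsNorm_msqrt_sub_msqrt_le hρ hDD
    _ = hsNorm (msqrt ρ - D) := by rw [msqrt_mul_self hD]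

end IsProjectiveMeasurement

end Pinching

section WeakMeasurement

variable {a b : Type*} [Fintype a] [Fintype b] [DecidableEq b] {m : ℕ}

theorem localMeas_eq_pinching (P : Fin m → Matrix a a ℂ) (X : Matrix (a × b) (a × b) ℂ) :
    localMeas P X = pinching (fun k => P k ⊗ₖ (1 : Matrix b b ℂ)) X :=
  (pinching_apply _ _).symm

theorem tau₁_sq_add_tau₂_sq (x : ℝ) : tau₁ x ^ 2 + tau₂ x ^ 2 = 1 := by
  rw [tau₁, tau₂, Real.sq_sqrt (by linarith [Real.tanh_lt_one x]),
    Real.sq_sqrt (by linarith [Real.neg_one_lt_tanh x])]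
  ring

variable [DecidableEq a]

theorem IsProjectiveMeasurement.kronecker_one {P : Fin m → Matrix a a ℂ}
    (hP : IsProjectiveMeasurement P) :
    IsProjectiveMeasurement fun k => P k ⊗ₖ (1 : Matrix b b ℂ) where
  hermitian k := by
    rw [IsHermitian, conjTranspose_kronecker, (hP.hermitian k).eq, conjTranspose_one]
  idem k := by rw [← mul_kronecker_mul, hP.idem, Matrix.one_mul]
  orthogonal j k h := by rw [← mul_kronecker_mul, hP.orthogonal j k h, zero_kronecker]
  complete := by rw [← sum_kronecker, hP.complete, one_kronecker_one]

theorem weakMeas_eq_weakMeasMix (x : ℝ) {P : Fin 2 → Matrix a a ℂ} (hP : ∑ k, P k = 1) :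
    weakMeas (b := b) x P = weakMeasMix x P := by
  funext X
  have hτ : (tau₁ x : ℂ) ^ 2 + (tau₂ x : ℂ) ^ 2 = 1 := by exact_mod_cast tau₁_sq_add_tau₂_sq x
  have hsum : P 0 ⊗ₖ (1 : Matrix b b ℂ) + P 1 ⊗ₖ 1 = 1 := by
    rw [← add_kronecker, ← Fin.sum_univ_two, hP, one_kronecker_one]
  simp only [weakMeas, weakMeasMix, weakOpPos, weakOpNeg, localMeas, Fin.sum_univ_two,
    add_kronecker, smul_kronecker]
  set A := P 0 ⊗ₖ (1 : Matrix b b ℂ)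
  set B := P 1 ⊗ₖ (1 : Matrix b b ℂ)
  set s : ℂ := (tau₁ x : ℂ)
  set t : ℂ := (tau₂ x : ℂ)
  have hX : A * X * B + B * X * A = X - (A * X * A + B * X * B) := by
    calc
      A * X * B + B * X * A = (A + B) * X * (A + B) - (A * X * A + B * X * B) := by noncomm_ring
      _ = X - (A * X * A + B * X * B) := by rw [hsum, Matrix.one_mul, Matrix.mul_one]
  calc
    (s • A + t • B) * X * (s • A + t • B) + (t • A + s • B) * X * (t • A + s • B) =
        (s ^ 2 + t ^ 2) • (A * X * A + B * X * B) +
          (2 * s * t) • (A * X * B + B * X * A) := by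
      simp only [Matrix.add_mul, Matrix.mul_add, Matrix.smul_mul, Matrix.mul_smul]
      module
    _ = ((2 * tau₁ x * tau₂ x : ℝ) : ℂ) • X +
        ((1 - 2 * tau₁ x * tau₂ x : ℝ) : ℂ) • (A * X * A + B * X * B) := by
      rw [hτ, hX]
      push_cast
      module

theorem coherence_weakMeasMix (x : ℝ) (P : Fin m → Matrix a a ℂ) (ρ : Matrix (a × b) (a × b) ℂ) :
    coherence (weakMeasMix x P) ρ =
      (1 - 2 * tau₁ x * tau₂ x) ^ 2 * coherence (localMeas P) ρ := by
  rw [coherence, coherence, ← hsNorm_ofReal_smul_sq]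
  congr 2
  rw [weakMeasMix]
  push_cast
  module

variable {P : Fin m → Matrix a a ℂ} {Φ : Matrix (a × b) (a × b) ℂ →ₗ[ℂ] Matrix (a × b) (a × b) ℂ}

theorem IsPartiallyIncoherentCPTP.localMeas_map (hΦ : IsPartiallyIncoherentCPTP P Φ)
    {σ : Matrix (a × b) (a × b) ℂ} (hσ : σ.PosSemidef) (hPσ : localMeas P σ = σ) :
    localMeas P (Φ σ) = Φ σ := by
  rw [localMeas_eq_pinching] at hPσ ⊢
  obtain h0 | h0 := eq_or_ne σ.trace 0
  · rw [hσ.trace_eq_zero_iff.1 h0, map_zero, map_zero]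
  have hmem : σ.trace⁻¹ • σ ∈ partiallyIncoherent b P := by
    refine ⟨⟨hσ.smul (inv_nonneg.2 hσ.trace_nonneg), ?_⟩, ?_⟩
    · rw [trace_smul, smul_eq_mul, inv_mul_cancel₀ h0]
    · rw [localMeas_eq_pinching, map_smul, hPσ]
  have hfixed := (hΦ.2 ⟨_, hmem, rfl⟩).2
  rw [localMeas_eq_pinching, map_smul, map_smul] at hfixed
  exact smul_right_injective _ (inv_ne_zero h0) hfixed

theorem IsProjectiveMeasurement.coherence_localMeas_map_le (hP : IsProjectiveMeasurement P)
    (hΦ : IsPartiallyIncoherentCPTP P Φ) {ρ : Matrix (a × b) (a × b) ℂ} (hρ : ρ.PosSemidef) :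
    coherence (localMeas P) (Φ ρ) ≤ coherence (localMeas P) ρ := by
  have hΦP (σ : Matrix (a × b) (a × b) ℂ) (hσ : σ.PosSemidef)
      (hPσ : pinching (fun k => P k ⊗ₖ (1 : Matrix b b ℂ)) σ = σ) :
      pinching (fun k => P k ⊗ₖ (1 : Matrix b b ℂ)) (Φ σ) = Φ σ := by
    rw [← localMeas_eq_pinching] at hPσ ⊢
    exact hΦ.localMeas_map hσ hPσ
  simp only [coherence, localMeas_eq_pinching]
  gcongr
  · exact hsNorm_nonneg _
  · exact hP.kronecker_one.hsNorm_msqrt_sub_pinching_msqrt_map_le hΦ.1 hΦP hρ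

theorem IsProjectiveMeasurement.coherence_weakMeasMix_map_le (hP : IsProjectiveMeasurement P)
    (hΦ : IsPartiallyIncoherentCPTP P Φ) (x : ℝ) {ρ : Matrix (a × b) (a × b) ℂ}
    (hρ : ρ.PosSemidef) :
    coherence (weakMeasMix x P) (Φ ρ) ≤ coherence (weakMeasMix x P) ρ := by
  rw [coherence_weakMeasMix, coherence_weakMeasMix]
  exact mul_le_mul_of_nonneg_left (hP.coherence_localMeas_map_le hΦ hρ) (sq_nonneg _)

end WeakMeasurement

end WeakCoherence

theorem mainTheorem3 {a b : Type*} [Fintype a] [DecidableEq a] [Fintype b] [DecidableEq b]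
    (x : ℝ) (ρ : Matrix (a × b) (a × b) ℂ) (hρ : WeakCoherence.IsState ρ)
    (Φ : Matrix (a × b) (a × b) ℂ →ₗ[ℂ] Matrix (a × b) (a × b) ℂ) :
    (∀ P : Fin 2 → Matrix a a ℂ, WeakCoherence.IsProjectiveMeasurement P →
      WeakCoherence.IsPartiallyIncoherentCPTP P Φ →
        WeakCoherence.coherence (WeakCoherence.weakMeas x P) (Φ ρ) ≤
          WeakCoherence.coherence (WeakCoherence.weakMeas x P) ρ) ∧
    (∀ (m : ℕ) (P : Fin m → Matrix a a ℂ), WeakCoherence.IsProjectiveMeasurement P →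
      WeakCoherence.IsPartiallyIncoherentCPTP P Φ →
        WeakCoherence.coherence (WeakCoherence.weakMeasMix x P) (Φ ρ) ≤
          WeakCoherence.coherence (WeakCoherence.weakMeasMix x P) ρ) := by
  refine ⟨fun P hP hΦ => ?_, fun m P hP hΦ => hP.coherence_weakMeasMix_map_le hΦ x hρ.1⟩
  rw [WeakCoherence.weakMeas_eq_weakMeasMix x hP.complete]
  exact hP.coherence_weakMeasMix_map_le hΦ x hρ.1
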